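/- Let $n$ and $m$ be positive integers and let $R^n_m$ be the undirected simple graph with vertex set $\mathbb{Z}_m^n=(\mathbb{Z}/m\mathbb{Z})^n$ in which two distinct vertices $\epsilon,\epsilon'$ are joined by an edge if and only if $\epsilon'=\epsilon+\delta \pmod m$ for some nonzero $\delta\in\{-1,0,1\}^n$. For $A\subseteq\mathbb{Z}_m^n$ let the edge boundary $\partial_R A$ be the set of (undirected) edges $\{\epsilon,\epsilon'\}$ of $R^n_m$ with $|\{\epsilon,\epsilon'\}\cap A|=1$. Suppose that $|A|\le m^n/2$ and, in the case $n=1$, that $m\ne 2$ and $A\ne\emptyset$. Then $$|\partial_R A|\ \ge\ 2\,|A|^{(n-1)/n}.$$ -/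

import Mathlib

/-- The graph `R^n_m` on `ℤ_m^n`: two distinct vertices are adjacent when they differ by a nonzero
`δ ∈ {-1, 0, 1}^n`. The clause `x ≠ y` removes loops and matters only for `m = 1`. -/
def torusGraph (n m : ℕ) : SimpleGraph (Fin n → ZMod m) where
  Adj x y := x ≠ y ∧ ∃ δ : Fin n → ℤ, δ ≠ 0 ∧ (∀ i, δ i ∈ ({-1, 0, 1} : Set ℤ)) ∧
    y = fun i => x i + (δ i : ZMod m)
  symm := ⟨by
    rintro x y ⟨hne, δ, h0, hδ, rfl⟩
    refine ⟨hne.symm, -δ, neg_ne_zero.mpr h0, fun i => ?_, ?_⟩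
    · rcases hδ i with h | h | h <;> simp_all
    · funext i
      simp⟩
  loopless := ⟨fun _ h => h.1 rfl⟩

/-- The edge boundary of a vertex set `A`: the (undirected) edges with exactly one endpoint
in `A`. -/
def edgeBoundary {V : Type*} (G : SimpleGraph V) (A : Set V) : Set (Sym2 V) :=
  {e | e ∈ G.edgeSet ∧ ((e : Set V) ∩ A).ncard = 1}

open Finset

/-! For `m ≥ 3`, induct on `n`, slicing `A` along the first coordinate. Sign vectors `(0, d)` act
within slices; induction bounds their loss, applied to the complement of a slice filling more than
half (`two_mul_min_rpow_le_outDegree`). A vector `(±1, d)` moves slices around a cycle, so it loses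
at least the largest slice size minus the smallest. Either the slices are uneven and the second kind
pays, or they are even and the first does; `mul_rpow_neg_le_sum_slices` balances the two. For `m =
2` the graph is complete and `|A| |Aᶜ|` suffices; `m = 1` forces `A` to be empty. -/

/-! ### Directed boundary counts -/

/-- The number of points of `A` that leave `A` under translation by `d`. -/
def translationLoss {G : Type*} [AddCommGroup G] [DecidableEq G] (d : G) (A : Finset G) : ℕ :=
  (A.filter fun x => x + d ∉ A).card

/-- Translation by `d` is a bijection, so as many points enter `A` as leave it. -/
theorem translationLoss_compl {G : Type*} [AddCommGroup G] [DecidableEq G] [Fintype G] (d : G)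
    (A : Finset G) : translationLoss d Aᶜ = translationLoss d A := by
  unfold translationLoss
  have h1 := Finset.card_filter_add_card_filter_not (s := A) (fun x => x + d ∈ A)
  have h2 : (univ.filter fun x : G => x + d ∈ A).card = A.card := by
    refine Finset.card_bij (fun x _ => x + d) (by simp) (by simp) fun y hy => ⟨y - d, by simpa, by simp⟩
  have h3 := Finset.card_filter_add_card_filter_not (s := univ.filter fun x : G => x + d ∈ A)
    (fun x => x ∈ A)
  rw [Finset.filter_filter, Finset.filter_filter] at h3
  have e1 : (univ.filter fun x : G => x + d ∈ A ∧ x ∈ A) = A.filter fun x => x + d ∈ A := by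
    ext x; simp [and_comm]
  have e2 : (univ.filter fun x : G => x + d ∈ A ∧ x ∉ A) = Aᶜ.filter fun x => x + d ∉ Aᶜ := by
    ext x; simp [and_comm]
  rw [e1, e2] at h3
  omega

/-- The nonzero vectors of `ℤ_m^n` with all coordinates in `{0, 1, -1}`. -/
def signVectors (n m : ℕ) [NeZero m] : Finset (Fin n → ZMod m) :=
  univ.filter fun d => d ≠ 0 ∧ ∀ i, d i = 0 ∨ d i = 1 ∨ d i = -1

/-- The number of ordered pairs `(x, x + d)` leaving `A`, with `d` a sign vector. -/
def outDegree {n m : ℕ} [NeZero m] (A : Finset (Fin n → ZMod m)) : ℕ :=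
  ∑ d ∈ signVectors n m, translationLoss d A

theorem outDegree_compl {n m : ℕ} [NeZero m] (A : Finset (Fin n → ZMod m)) :
    outDegree Aᶜ = outDegree A :=
  Finset.sum_congr rfl fun d _ => translationLoss_compl d A

theorem torusGraph_adj_add {n m : ℕ} [NeZero m] {d : Fin n → ZMod m} (hd : d ∈ signVectors n m)
    (x : Fin n → ZMod m) : (torusGraph n m).Adj x (x + d) := by
  simp only [signVectors, mem_filter, mem_univ, true_and] at hd
  obtain ⟨h0, h⟩ := hd
  have h' : ∀ i, ∃ c : ℤ, c ∈ ({-1, 0, 1} : Set ℤ) ∧ d i = (c : ZMod m) := by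
    intro i
    rcases h i with h | h | h
    · exact ⟨0, by simp, by simp [h]⟩
    · exact ⟨1, by simp, by simp [h]⟩
    · exact ⟨-1, by simp, by simp [h]⟩
  choose δ hδ hd using h'
  refine ⟨by simpa using h0, δ, ?_, hδ, funext fun i => by simp [hd]⟩
  rintro rfl
  exact h0 (funext fun i => by simp [hd])

/-- Adjacent ordered pairs from `A` to its complement inject into the edge boundary. -/
theorem card_le_ncard_edgeBoundary {V : Type*} [Finite V] (G : SimpleGraph V) (A : Set V)
    (P : Finset (V × V)) (hP : ∀ p ∈ P, p.1 ∈ A ∧ p.2 ∉ A ∧ G.Adj p.1 p.2) :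
    P.card ≤ (edgeBoundary G A).ncard := by
  rw [← Set.ncard_coe_finset P]
  refine Set.ncard_le_ncard_of_injOn (fun p => s(p.1, p.2)) ?_ ?_ (Set.toFinite _)
  · rintro ⟨x, y⟩ hp
    obtain ⟨hx, hy, hxy⟩ := hP _ hp
    refine ⟨hxy, ?_⟩
    rw [Set.ncard_eq_one]
    refine ⟨x, ?_⟩
    ext z
    simp only [Set.mem_inter_iff, SetLike.mem_coe, Sym2.mem_iff, Set.mem_singleton_iff]
    constructor
    · rintro ⟨rfl | rfl, hz⟩
      · rfl
      · exact absurd hz hy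
    · rintro rfl
      exact ⟨Or.inl rfl, hx⟩
  · rintro ⟨x, y⟩ hp ⟨x', y'⟩ hp' h
    obtain ⟨hx, hy, -⟩ := hP _ hp
    obtain ⟨hx', hy', -⟩ := hP _ hp'
    simp only [Sym2.eq_iff] at h
    rcases h with ⟨rfl, rfl⟩ | ⟨rfl, rfl⟩
    · rfl
    · exact absurd hx hy'

theorem outDegree_le_ncard_edgeBoundary {n m : ℕ} [NeZero m] (A : Finset (Fin n → ZMod m)) :
    outDegree A ≤ (edgeBoundary (torusGraph n m) (A : Set (Fin n → ZMod m))).ncard := by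
  unfold outDegree translationLoss
  rw [← Finset.card_sigma]
  set S := (signVectors n m).sigma fun d => A.filter fun x => x + d ∉ A
  have hinj : Set.InjOn (fun p : (_ : Fin n → ZMod m) × (Fin n → ZMod m) => (p.2, p.2 + p.1)) S := by
    rintro ⟨d, x⟩ - ⟨d', x'⟩ - h
    simp only [Prod.mk.injEq] at h
    obtain ⟨rfl, h⟩ := h
    rw [add_left_cancel h]
  rw [← Finset.card_image_of_injOn hinj]
  refine card_le_ncard_edgeBoundary _ _ _ fun p hp => ?_
  obtain ⟨⟨d, x⟩, hdx, rfl⟩ := Finset.mem_image.1 hp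
  simp only [S, mem_sigma, mem_filter] at hdx
  exact ⟨hdx.2.1, by simpa using hdx.2.2, torusGraph_adj_add hdx.1 x⟩

/-! ### Slices along the first coordinate -/

/-- The slice of `A` at first coordinate `t`. -/
def firstSlice {n m : ℕ} [NeZero m] (A : Finset (Fin (n + 1) → ZMod m)) (t : ZMod m) :
    Finset (Fin n → ZMod m) :=
  univ.filter fun y => (Fin.cons t y : Fin (n + 1) → ZMod m) ∈ A

theorem mem_firstSlice {n m : ℕ} [NeZero m] {A : Finset (Fin (n + 1) → ZMod m)} {t : ZMod m}
    {y : Fin n → ZMod m} : y ∈ firstSlice A t ↔ (Fin.cons t y : Fin (n + 1) → ZMod m) ∈ A := by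
  simp [firstSlice]

theorem card_eq_sum_card_firstSlice {n m : ℕ} [NeZero m] (A : Finset (Fin (n + 1) → ZMod m)) :
    A.card = ∑ t, (firstSlice A t).card := by
  rw [← Finset.card_sigma]
  refine Finset.card_bij' (fun x _ => ⟨x 0, Fin.tail x⟩) (fun p _ => Fin.cons p.1 p.2) ?_ ?_ ?_ ?_
  · intro x hx
    simpa [mem_firstSlice] using hx
  · rintro ⟨t, y⟩ h
    simpa [mem_firstSlice] using h
  · intro x _
    simp
  · rintro ⟨t, y⟩ _
    simp

theorem cons_add_cons {n m : ℕ} (t c : ZMod m) (y d : Fin n → ZMod m) :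
    (Fin.cons t y : Fin (n + 1) → ZMod m) + (Fin.cons c d : Fin (n + 1) → ZMod m) =
      (Fin.cons (t + c) (y + d) : Fin (n + 1) → ZMod m) := by
  funext i
  refine Fin.cases ?_ (fun j => ?_) i <;> simp

theorem translationLoss_cons {n m : ℕ} [NeZero m] (c : ZMod m) (d : Fin n → ZMod m)
    (A : Finset (Fin (n + 1) → ZMod m)) :
    translationLoss (Fin.cons c d : Fin (n + 1) → ZMod m) A =
      ∑ t, ((firstSlice A t).filter fun y => y + d ∉ firstSlice A (t + c)).card := by
  unfold translationLoss
  rw [card_eq_sum_card_firstSlice]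
  refine Finset.sum_congr rfl fun t _ => congrArg _ ?_
  ext y
  simp [mem_firstSlice, cons_add_cons]

theorem sum_translationLoss_cons_zero {n m : ℕ} [NeZero m] (A : Finset (Fin (n + 1) → ZMod m)) :
    ∑ d ∈ signVectors n m, translationLoss (Fin.cons 0 d : Fin (n + 1) → ZMod m) A =
      ∑ t, outDegree (firstSlice A t) := by
  simp_rw [translationLoss_cons, add_zero, outDegree]
  exact Finset.sum_comm

/-- On a cycle, the total descent is at least the difference of any two values. -/
theorem sub_le_sum_of_cyclic_descent {m : ℕ} [NeZero m] (f g : ZMod m → ℤ) (hg : ∀ t, 0 ≤ g t)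
    (h : ∀ t, f t - f (t + 1) ≤ g t) (s r : ZMod m) : f s - f r ≤ ∑ t, g t := by
  have h1 : f s - f r = ∑ k ∈ range (r - s).val, (f (s + k) - f (s + (k + 1 : ℕ))) := by
    rw [Finset.sum_range_sub' fun k : ℕ => f (s + k)]
    simp
  have hinj : Set.InjOn (fun k : ℕ => s + (k : ZMod m)) (range (r - s).val : Finset ℕ) := by
    intro a ha b hb hab
    have hlt := ZMod.val_lt (r - s)
    simp only [coe_range, Set.mem_Iio] at ha hb
    have hab' := add_left_cancel hab
    have := congrArg ZMod.val hab'
    rwa [ZMod.val_cast_of_lt (ha.trans hlt), ZMod.val_cast_of_lt (hb.trans hlt)] at this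
  calc f s - f r = ∑ k ∈ range (r - s).val, (f (s + k) - f (s + (k + 1 : ℕ))) := h1
    _ ≤ ∑ k ∈ range (r - s).val, g (s + k) := by
        refine Finset.sum_le_sum fun k _ => ?_
        have := h (s + k)
        rwa [add_assoc, ← Nat.cast_succ] at this
    _ = ∑ t ∈ (range (r - s).val).image (fun k : ℕ => s + (k : ZMod m)), g t :=
        (Finset.sum_image hinj).symm
    _ ≤ ∑ t, g t := Finset.sum_le_sum_of_subset_of_nonneg (subset_univ _) fun t _ _ => hg t

theorem card_sub_card_le_card_filter {G : Type*} [AddCommGroup G] [DecidableEq G] (d : G)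
    (B C : Finset G) : (B.card : ℤ) - C.card ≤ (B.filter fun y => y + d ∉ C).card := by
  have h1 := Finset.card_filter_add_card_filter_not (s := B) (fun x => x + d ∈ C)
  have h2 : (B.filter fun y => y + d ∈ C).card ≤ C.card :=
    Finset.card_le_card_of_injOn (fun x => x + d) (fun x hx => by simp at hx; exact hx.2) (by simp)
  omega

theorem card_firstSlice_sub_le_translationLoss {n m : ℕ} [NeZero m] (A : Finset (Fin (n + 1) → ZMod m))
    (c : ZMod m) (hc : c = 1 ∨ c = -1) (d : Fin n → ZMod m) (s r : ZMod m) :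
    ((firstSlice A s).card : ℤ) - (firstSlice A r).card ≤
      translationLoss (Fin.cons c d : Fin (n + 1) → ZMod m) A := by
  rw [translationLoss_cons]
  push_cast
  rcases hc with rfl | rfl
  · exact sub_le_sum_of_cyclic_descent (fun t => ((firstSlice A t).card : ℤ)) _
      (fun t => Nat.cast_nonneg _) (fun t => card_sub_card_le_card_filter d _ _) s r
  -- Reflecting the cycle turns steps by `-1` into steps by `1`.
  · rw [← Equiv.sum_comp (Equiv.neg (ZMod m))]
    have := sub_le_sum_of_cyclic_descent (fun t => ((firstSlice A (-t)).card : ℤ))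
      (fun t => (((firstSlice A (-t)).filter fun y => y + d ∉ firstSlice A (-t + -1)).card : ℤ))
      (fun t => Nat.cast_nonneg _)
      (fun t => by
        have := card_sub_card_le_card_filter d (firstSlice A (-t)) (firstSlice A (-t + -1))
        rwa [neg_add]) (-s) (-r)
    simpa using this

theorem cons_mem_signVectors {n m : ℕ} [NeZero m] {c : ZMod m} {d : Fin n → ZMod m}
    (hc : c = 0 ∨ c = 1 ∨ c = -1) (hd : ∀ i, d i = 0 ∨ d i = 1 ∨ d i = -1) (h : c ≠ 0 ∨ d ≠ 0) :
    (Fin.cons c d : Fin (n + 1) → ZMod m) ∈ signVectors (n + 1) m := by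
  simp only [signVectors, mem_filter, mem_univ, true_and]
  refine ⟨fun h0 => ?_, Fin.cases (by simpa using hc) (fun i => by simpa using hd i)⟩
  have e0 : c = 0 := by simpa using congrFun h0 0
  have e1 : d = 0 := funext fun i => by simpa using congrFun h0 i.succ
  tauto

/-- Splitting the outgoing pairs into those within slices and those between slices. -/
theorem sum_outDegree_firstSlice_add_le {n m : ℕ} [NeZero m] (hm : 3 ≤ m)
    (A : Finset (Fin (n + 1) → ZMod m)) (T : Finset (Fin n → ZMod m))
    (hT : ∀ d ∈ T, ∀ i, d i = 0 ∨ d i = 1 ∨ d i = -1) (s r : ZMod m) :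
    (∑ t, (outDegree (firstSlice A t) : ℤ)) +
      2 * T.card * (((firstSlice A s).card : ℤ) - (firstSlice A r).card) ≤ outDegree A := by
  have : Fact (2 < m) := ⟨hm⟩
  have : Fact (1 < m) := ⟨by omega⟩
  have hone : (1 : ZMod m) ≠ -1 := (ZMod.neg_one_ne_one).symm
  set P : Finset (ZMod m × (Fin n → ZMod m)) :=
    ({0} ×ˢ signVectors n m) ∪ ({1, -1} ×ˢ T) with hP
  have hdisj : Disjoint (({0} : Finset (ZMod m)) ×ˢ signVectors n m) ({1, -1} ×ˢ T) := by
    rw [Finset.disjoint_left]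
    rintro ⟨c, d⟩ h1 h2
    simp only [mem_product, mem_singleton, mem_insert] at h1 h2
    rcases h2.1 with h | h <;> simp [h] at h1
  have hinj : Function.Injective
      fun p : ZMod m × (Fin n → ZMod m) => (Fin.cons p.1 p.2 : Fin (n + 1) → ZMod m) := by
    rintro ⟨c, d⟩ ⟨c', d'⟩ h
    obtain ⟨h1, h2⟩ := Fin.cons_injective2 h
    exact Prod.ext h1 h2
  have hsub : P.image (fun p => (Fin.cons p.1 p.2 : Fin (n + 1) → ZMod m)) ⊆
      signVectors (n + 1) m := by
    intro x hx
    obtain ⟨⟨c, d⟩, hp, rfl⟩ := Finset.mem_image.1 hx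
    rcases Finset.mem_union.1 hp with hp | hp <;>
      simp only [mem_product, mem_singleton, mem_insert] at hp
    · have hd := hp.2
      simp only [signVectors, mem_filter, mem_univ, true_and] at hd
      exact cons_mem_signVectors (Or.inl hp.1) hd.2 (Or.inr hd.1)
    · refine cons_mem_signVectors (Or.inr hp.1) (hT _ hp.2) (Or.inl ?_)
      rcases hp.1 with h | h <;> simp [h]
  have h1 : (∑ p ∈ P, (translationLoss (Fin.cons p.1 p.2 : Fin (n + 1) → ZMod m) A : ℤ)) ≤
      outDegree A := by
    unfold outDegree
    push_cast
    rw [← Finset.sum_image (f := fun d => (translationLoss d A : ℤ)) hinj.injOn]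
    exact Finset.sum_le_sum_of_subset_of_nonneg hsub fun _ _ _ => Nat.cast_nonneg _
  refine le_trans ?_ h1
  rw [hP, Finset.sum_union hdisj, Finset.sum_product, Finset.sum_singleton]
  refine add_le_add (le_of_eq ?_) ?_
  · exact_mod_cast (sum_translationLoss_cons_zero A).symm
  · have hcard : ((({1, -1} : Finset (ZMod m)) ×ˢ T).card : ℤ) = 2 * T.card := by
      -- `m ≥ 3` enters here: `1` and `-1` are distinct.
      rw [card_product, card_pair hone]
      push_cast
      rfl
    rw [← hcard, ← nsmul_eq_mul]
    refine Finset.card_nsmul_le_sum _ _ _ ?_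
    rintro ⟨c, d⟩ hp
    simp only [mem_product, mem_singleton, mem_insert] at hp
    exact card_firstSlice_sub_le_translationLoss A c hp.1 d s r

/-! ### The numerical inequality -/

theorem mul_rpow_neg_le {x y q : ℝ} (hx : 0 ≤ x) (hxy : x ≤ y) (hq : 0 ≤ q) :
    x * y ^ (-q) ≤ x * x ^ (-q) := by
  rcases hx.eq_or_lt with rfl | hx
  · simp
  · exact mul_le_mul_of_nonneg_left (Real.rpow_le_rpow_of_nonpos hx hxy (by linarith)) hx.le

/-- The numerical inequality behind the induction step: `a t` are the slice sizes, `V = m ^ n` the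
size of a full slice. -/
theorem mul_rpow_neg_le_sum_slices {ι : Type*} [Fintype ι] {n m : ℕ} (hn : 0 < n) (hm : 0 < m)
    (hι : Fintype.card ι = m) (a : ι → ℝ) (s r : ι) (h0 : ∀ t, 0 ≤ a t)
    (hV : ∀ t, a t ≤ (m : ℝ) ^ n) (hs : ∀ t, a t ≤ a s) (hr : ∀ t, a r ≤ a t)
    (hN : ∑ t, a t ≤ (m : ℝ) ^ (n + 1) / 2) :
    (∑ t, a t) * (∑ t, a t) ^ (-(1 / ((n + 1 : ℕ) : ℝ))) ≤
      2 * (a s - a r) + ∑ t, min (a t) ((m : ℝ) ^ n - a t) *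
        (min (a t) ((m : ℝ) ^ n - a t)) ^ (-(1 / (n : ℝ))) := by
  have hm' : (0 : ℝ) < m := by exact_mod_cast hm
  have hn' : (1 : ℝ) ≤ n := by exact_mod_cast hn
  set V : ℝ := (m : ℝ) ^ n with hVdef
  have hVpos : 0 < V := by positivity
  set N := ∑ t, a t with hNdef
  set q : ℝ := 1 / (n : ℝ) with hq
  have hq0 : 0 < q := by positivity
  have hq1 : q ≤ 1 := by rw [hq, div_le_one (by linarith)]; exact hn'
  have hVq : V ^ (-q) = 1 / m := by
    rw [hVdef, Real.rpow_neg (by positivity), ← Real.rpow_natCast, ← Real.rpow_mul hm'.le, hq,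
      mul_one_div_cancel (by linarith), Real.rpow_one, one_div]
  have hNV : N ≤ m * V / 2 := by rw [pow_succ] at hN; linarith
  have hmr : m * a r ≤ N := by
    have := Finset.card_nsmul_le_sum univ a (a r) fun t _ => hr t
    rwa [card_univ, hι, nsmul_eq_mul] at this
  have hrV : a r ≤ V / 2 := by nlinarith
  have hN0 : 0 ≤ N := Finset.sum_nonneg fun t _ => h0 t
  rcases hN0.eq_or_lt with hN0 | hNpos
  · rw [← hN0, zero_mul]
    refine add_nonneg (by linarith [hs r]) (Finset.sum_nonneg fun t _ => ?_)
    have : 0 ≤ min (a t) (V - a t) := le_min (h0 t) (by linarith [hV t])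
    positivity
  have hspos : 0 < a s := by
    by_contra hneg
    have : N ≤ 0 := Finset.sum_nonpos fun t _ => (hs t).trans (not_lt.1 hneg)
    linarith
  set k : ℝ := ((n + 1 : ℕ) : ℝ) with hk
  have hkn : k = n + 1 := by rw [hk]; push_cast; rfl
  have hW : N * N ^ (-(1 / k)) = N ^ (1 - 1 / k) := by
    rw [sub_eq_add_neg, Real.rpow_add hNpos, Real.rpow_one]
  have hdiff : 0 ≤ a s - a r := by linarith [hs r]
  rcases le_or_gt (a s) (V / 2) with hsV | hsV
  · have hb : ∀ t, min (a t) (V - a t) = a t := fun t => min_eq_left (by linarith [hs t])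
    simp only [hb]
    -- If `a s ≤ N ^ (1 - 1/k)`, the slice terms suffice, as `(1 - 1/k) / n = 1/k`. Otherwise they
    -- still give `N / m ≥ a r`, and adding `a s - a r` already exceeds the target.
    rcases le_or_gt (a s) (N * N ^ (-(1 / k))) with hsW | hsW
    · have h1 : N * (a s) ^ (-q) ≤ ∑ t, a t * a t ^ (-q) := by
        rw [hNdef, Finset.sum_mul]
        exact Finset.sum_le_sum fun t _ => mul_rpow_neg_le (h0 t) (hs t) hq0.le
      have h2 : N * N ^ (-(1 / k)) ≤ N * (a s) ^ (-q) := by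
        refine mul_le_mul_of_nonneg_left ?_ hNpos.le
        have h3 := Real.rpow_le_rpow_of_nonpos hspos hsW (by linarith : -q ≤ 0)
        refine le_trans (le_of_eq ?_) h3
        rw [hW, ← Real.rpow_mul hNpos.le]
        congr 1
        rw [hq, hkn]
        have : (n : ℝ) ≠ 0 := by linarith
        have : (n : ℝ) + 1 ≠ 0 := by linarith
        field_simp
        ring
      linarith
    · have h1 : N / m ≤ ∑ t, a t * a t ^ (-q) := by
        rw [hNdef, Finset.sum_div]
        refine Finset.sum_le_sum fun t _ => ?_
        have := mul_rpow_neg_le (h0 t) (hV t) hq0.le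
        rwa [hVq, mul_one_div] at this
      have h2 : a r ≤ N / m := by rw [le_div_iff₀ hm']; linarith
      linarith
  -- With `D = a s - a r`, the slice terms give `(V / 2 - D) * 2 ^ q`; since `2 ^ q ≤ 2`, the extra
  -- `2 * D` restores `V / 2 * 2 ^ q`, which bounds the target.
  · have h2q : (V / 2) ^ (-q) = 2 ^ q / m := by
      rw [Real.div_rpow hVpos.le (by norm_num), hVq, Real.rpow_neg (by norm_num)]
      field_simp
    have h2q2 : (2 : ℝ) ^ q ≤ 2 := by
      simpa using Real.rpow_le_rpow_of_exponent_le (by norm_num : (1 : ℝ) ≤ 2) hq1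
    have hterm : ∀ t, (V / 2 - (a s - a r)) * (2 ^ q / m) ≤
        min (a t) (V - a t) * (min (a t) (V - a t)) ^ (-q) := by
      intro t
      have hb0 : 0 ≤ min (a t) (V - a t) := le_min (h0 t) (by linarith [hV t])
      have hb1 : min (a t) (V - a t) ≤ V / 2 := by
        rcases le_total (a t) (V / 2) with h | h
        · exact (min_le_left _ _).trans h
        · exact (min_le_right _ _).trans (by linarith)
      have hb2 : V / 2 - (a s - a r) ≤ min (a t) (V - a t) :=
        le_min (by linarith [hr t]) (by linarith [hs t])
      have := mul_rpow_neg_le hb0 hb1 hq0.le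
      rw [h2q] at this
      exact (mul_le_mul_of_nonneg_right hb2 (by positivity)).trans this
    have hsum : (V / 2 - (a s - a r)) * 2 ^ q ≤
        ∑ t, min (a t) (V - a t) * (min (a t) (V - a t)) ^ (-q) := by
      have := Finset.card_nsmul_le_sum univ _ _ fun t _ => hterm t
      rw [card_univ, hι, nsmul_eq_mul] at this
      refine le_trans (le_of_eq ?_) this
      field_simp
    have hWV : N * N ^ (-(1 / k)) ≤ V / 2 * 2 ^ q := by
      have hk1 : 0 ≤ 1 - 1 / k := by
        rw [hkn, sub_nonneg, div_le_one (by linarith)]; linarith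
      have hkq : 1 / k ≤ q := by
        rw [hkn, hq]; exact one_div_le_one_div_of_le (by linarith) (by linarith)
      rw [hW]
      calc N ^ (1 - 1 / k) ≤ (m * V / 2) ^ (1 - 1 / k) :=
            Real.rpow_le_rpow hNpos.le hNV hk1
        _ = V * (2 : ℝ) ^ (-(1 - 1 / k)) := by
            rw [Real.div_rpow (by positivity) (by norm_num), Real.rpow_neg (by norm_num),
              ← div_eq_mul_inv]
            congr 1
            rw [hVdef, mul_comm, ← pow_succ, ← Real.rpow_natCast, ← Real.rpow_mul hm'.le,
              ← Real.rpow_natCast]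
            congr 1
            rw [← hk, mul_sub, mul_one, mul_one_div_cancel (by linarith), hkn]
            ring
        _ ≤ V * (2 : ℝ) ^ (q - 1) := by
            refine mul_le_mul_of_nonneg_left ?_ hVpos.le
            exact Real.rpow_le_rpow_of_exponent_le (by norm_num) (by linarith)
        _ = V / 2 * 2 ^ q := by
            rw [Real.rpow_sub (by norm_num), Real.rpow_one]; ring
    nlinarith

/-! ### The induction for `m ≥ 3` -/

theorem card_firstSlice_le {n m : ℕ} [NeZero m] (A : Finset (Fin (n + 1) → ZMod m)) (t : ZMod m) :
    (firstSlice A t).card ≤ m ^ n := by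
  simpa using Finset.card_le_univ (firstSlice A t)

theorem two_mul_min_rpow_le_outDegree {n m : ℕ} [NeZero m]
    (h : ∀ A : Finset (Fin n → ZMod m), (A.card : ℝ) ≤ (m : ℝ) ^ n / 2 →
      2 * ((A.card : ℝ) * (A.card : ℝ) ^ (-(1 / (n : ℝ)))) ≤ outDegree A)
    (A : Finset (Fin n → ZMod m)) :
    2 * (min (A.card : ℝ) ((m : ℝ) ^ n - A.card) *
      (min (A.card : ℝ) ((m : ℝ) ^ n - A.card)) ^ (-(1 / (n : ℝ)))) ≤ outDegree A := by
  rcases le_total (A.card : ℝ) ((m : ℝ) ^ n / 2) with hA | hA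
  · rw [min_eq_left (by linarith)]
    exact h A hA
  · have hc : ((Aᶜ.card : ℕ) : ℝ) = (m : ℝ) ^ n - A.card := by
      rw [card_compl, Nat.cast_sub (card_le_univ A)]
      simp
    rw [min_eq_right (by linarith), ← outDegree_compl, ← hc]
    exact h Aᶜ (by linarith)

/-- The product `x * x ^ (-1/n)` replaces `x ^ (1 - 1/n)` because it vanishes at `x = 0` even for `n
= 1`, so empty slices need no exception. -/
theorem two_mul_card_rpow_le_outDegree {m : ℕ} [NeZero m] (hm : 3 ≤ m) {n : ℕ} (hn : 1 ≤ n) :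
    ∀ A : Finset (Fin n → ZMod m), (A.card : ℝ) ≤ (m : ℝ) ^ n / 2 →
      2 * ((A.card : ℝ) * (A.card : ℝ) ^ (-(1 / (n : ℝ)))) ≤ outDegree A := by
  have hm' : (3 : ℝ) ≤ m := by exact_mod_cast hm
  induction n, hn using Nat.le_induction with
  | base =>
    intro A hA
    have hsum := card_eq_sum_card_firstSlice A
    have hle : ∀ t, (firstSlice A t).card ≤ 1 := fun t => by simpa using card_firstSlice_le A t
    rcases A.card.eq_zero_or_pos with h0 | hpos
    · simp [h0]
    obtain ⟨s, -, hs⟩ : ∃ s ∈ univ, (firstSlice A s).card ≠ 0 := by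
      apply Finset.exists_ne_zero_of_sum_ne_zero
      omega
    obtain ⟨r, hr⟩ : ∃ r, (firstSlice A r).card = 0 := by
      -- Without an empty slice, `A` would have `m > m / 2` points.
      by_contra! hne
      have h1 : ∀ t, (firstSlice A t).card = 1 := fun t => le_antisymm (hle t) (Nat.pos_of_ne_zero (hne t))
      simp only [h1, sum_const, card_univ, ZMod.card, smul_eq_mul, mul_one] at hsum
      rw [hsum] at hA
      norm_num at hA
      linarith
    have hs1 : (firstSlice A s).card = 1 := le_antisymm (hle s) (Nat.pos_of_ne_zero hs)
    have key := sum_outDegree_firstSlice_add_le hm A {0} (by simp) s r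
    rw [hs1, hr] at key
    have h2 : (0 : ℤ) ≤ ∑ t, (outDegree (firstSlice A t) : ℤ) :=
      Finset.sum_nonneg fun _ _ => Nat.cast_nonneg _
    have h3 : (2 : ℤ) ≤ outDegree A := by simp at key; linarith
    have h4 : (2 : ℝ) ≤ outDegree A := by exact_mod_cast h3
    have hApos : (0 : ℝ) < A.card := by exact_mod_cast hpos
    simpa [Real.rpow_neg_one, hApos.ne'] using h4
  | succ n hn ih =>
    intro A hA
    obtain ⟨s, -, hs⟩ := Finset.exists_max_image univ (fun t => (firstSlice A t).card) univ_nonempty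
    obtain ⟨r, -, hr⟩ := Finset.exists_min_image univ (fun t => (firstSlice A t).card) univ_nonempty
    have : Fact (1 < m) := ⟨by omega⟩
    have h01 : (0 : Fin n → ZMod m) ≠ 1 := fun h => by
      simpa using congrFun h ⟨0, hn⟩
    -- Two vectors in `T` give the coefficient `4`, twice the `2` in the numerical inequality.
    have key := sum_outDegree_firstSlice_add_le hm A {0, 1} (by simp) s r
    rw [card_pair h01] at key
    have key' : (∑ t, (outDegree (firstSlice A t) : ℝ)) +
        2 * (2 : ℕ) * (((firstSlice A s).card : ℝ) - (firstSlice A r).card) ≤ outDegree A := by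
      exact_mod_cast key
    have hsum : (A.card : ℝ) = ∑ t, ((firstSlice A t).card : ℝ) := by
      exact_mod_cast card_eq_sum_card_firstSlice A
    have num := mul_rpow_neg_le_sum_slices (n := n) (m := m) hn (by omega) (ZMod.card m)
      (fun t => ((firstSlice A t).card : ℝ)) s r (fun t => Nat.cast_nonneg _)
      (fun t => by exact_mod_cast card_firstSlice_le A t)
      (fun t => by exact_mod_cast hs t (mem_univ t)) (fun t => by exact_mod_cast hr t (mem_univ t))
      (by rw [← hsum]; exact hA)
    rw [← hsum] at num
    have hslices := Finset.sum_le_sum fun t (_ : t ∈ (univ : Finset (ZMod m))) =>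
      two_mul_min_rpow_le_outDegree ih (firstSlice A t)
    rw [← Finset.mul_sum] at hslices
    push_cast at key' num ⊢
    linarith

/-! ### The case `m = 2` and the conclusion -/

theorem torusGraph_two_adj {n : ℕ} {x y : Fin n → ZMod 2} (h : x ≠ y) :
    (torusGraph n 2).Adj x y := by
  have hd : y - x ∈ signVectors n 2 := by
    simp only [signVectors, mem_filter, mem_univ, true_and]
    refine ⟨sub_ne_zero.2 h.symm, fun i => ?_⟩
    generalize (y - x) i = z
    revert z
    decide
  simpa using torusGraph_adj_add hd x

theorem card_mul_card_compl_le_ncard_edgeBoundary {n : ℕ} (A : Finset (Fin n → ZMod 2)) :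
    A.card * Aᶜ.card ≤ (edgeBoundary (torusGraph n 2) (A : Set (Fin n → ZMod 2))).ncard := by
  rw [← Finset.card_product]
  refine card_le_ncard_edgeBoundary _ _ _ fun p hp => ?_
  simp only [mem_product, mem_compl] at hp
  refine ⟨hp.1, hp.2, torusGraph_two_adj fun h => hp.2 (h ▸ hp.1)⟩

theorem theorem4p1 (n m : ℕ) (hn : 0 < n) (hm : 0 < m) (A : Finset (Fin n → ZMod m))
    (hA : (A.card : ℝ) ≤ (m : ℝ) ^ n / 2)
    (h_one : n = 1 → m ≠ 2 ∧ A.Nonempty) :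
    2 * (A.card : ℝ) ^ (((n : ℝ) - 1) / (n : ℝ)) ≤
      ((edgeBoundary (torusGraph n m) (A : Set (Fin n → ZMod m))).ncard : ℝ) := by
  have : NeZero m := ⟨hm.ne'⟩
  have hn' : (1 : ℝ) ≤ n := by exact_mod_cast hn
  have hexp : ((n : ℝ) - 1) / n = 1 + -(1 / (n : ℝ)) := by field_simp; ring
  rcases A.card.eq_zero_or_pos with h0 | hpos
  · have hn1 : n ≠ 1 := fun h => (h_one h).2.card_pos.ne' h0
    have hn2 : (2 : ℝ) ≤ n := by exact_mod_cast (by omega : 2 ≤ n)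
    rw [h0, Nat.cast_zero, Real.zero_rpow (div_pos (by linarith) (by linarith)).ne', mul_zero]
    exact Nat.cast_nonneg _
  have hApos : (1 : ℝ) ≤ A.card := by exact_mod_cast hpos
  obtain h1 | h2 | h3 : m = 1 ∨ m = 2 ∨ 3 ≤ m := by omega
  · subst h1
    norm_num at hA
    linarith
  · subst h2
    have hn1 : n ≠ 1 := fun h => (h_one h).1 rfl
    have hbd : ((A.card : ℝ) * Aᶜ.card) ≤
        ((edgeBoundary (torusGraph n 2) (A : Set (Fin n → ZMod 2))).ncard : ℝ) := by
      exact_mod_cast card_mul_card_compl_le_ncard_edgeBoundary A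
    have hc : ((Aᶜ.card : ℕ) : ℝ) = (2 : ℝ) ^ n - A.card := by
      rw [card_compl, Nat.cast_sub (card_le_univ A)]
      simp
    -- For `n ≥ 2` the complement has at least `2 ^ n / 2 ≥ 2` points, which supplies the factor
    -- `2`.
    have h4 : (2 : ℝ) ^ 2 ≤ 2 ^ n := pow_le_pow_right₀ (by norm_num) (by omega)
    have hle : (A.card : ℝ) ^ (((n : ℝ) - 1) / n) ≤ A.card := by
      have := Real.rpow_le_rpow_of_exponent_le hApos
        (show ((n : ℝ) - 1) / n ≤ 1 by rw [div_le_one (by linarith)]; linarith)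
      rwa [Real.rpow_one] at this
    push_cast at hA
    nlinarith
  · have h := two_mul_card_rpow_le_outDegree h3 hn A hA
    rw [hexp, Real.rpow_add (by linarith), Real.rpow_one]
    exact h.trans (by exact_mod_cast outDegree_le_ncard_edgeBoundary A)
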